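/- Work in first-order logic without equality, over a signature with infinitely many constants. Formulas are built from atomic formulas and the logical constants $\top,\bot$ (which do not count as atomic) by $\land,\lor,\supset,\forall,\exists$, and are identified up to renaming of bound variables. A sequent $\Gamma\vdash\Delta$ is a pair of finite multisets of formulas. It is an axiom if $\top\in\Delta$, or if some $A$ that is atomic or $\bot$ belongs to both $\Gamma$ and $\Delta$. The inference rules are (premises / conclusion): contr-L: $B,B,\Gamma\vdash\Delta\,/\,B,\Gamma\vdash\Delta$; contr-R: $\Gamma\vdash\Delta,B,B\,/\,\Gamma\vdash\Delta,B$; $\bot$-R: $\Gamma\vdash\Delta,\bot\,/\,\Gamma\vdash\Delta,D$; $\land$-L: $B,\Gamma\vdash\Delta\,/\,B\land D,\Gamma\vdash\Delta$ and $D,\Gamma\vdash\Delta\,/\,B\land D,\Gamma\vdash\Delta$; $\land$-R: $\Gamma\vdash\Delta,B$ and $\Gamma\vdash\Delta,D\,/\,\Gamma\vdash\Delta,B\land D$; $\lor$-L: $B,\Gamma\vdash\Delta$ and $D,\Gamma\vdash\Delta\,/\,B\lor D,\Gamma\vdash\Delta$; $\lor$-R: $\Gamma\vdash\Delta,B\,/\,\Gamma\vdash\Delta,B\lor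 D$ and $\Gamma\vdash\Delta,D\,/\,\Gamma\vdash\Delta,B\lor D$; $\supset$-L: $\Gamma\vdash\Delta,B$ and $D,\Gamma\vdash\Theta\,/\,B\supset D,\Gamma\vdash\Delta,\Theta$; $\supset$-R: $B,\Gamma\vdash\Delta,D\,/\,\Gamma\vdash\Delta,B\supset D$; $\forall$-L: $[t/x]B,\Gamma\vdash\Delta\,/\,\forall x B,\Gamma\vdash\Delta$; $\exists$-R: $\Gamma\vdash\Delta,[t/x]B\,/\,\Gamma\vdash\Delta,\exists x B$, for any term $t$; $\exists$-L: $[c/x]B,\Gamma\vdash\Delta\,/\,\exists x B,\Gamma\vdash\Delta$; $\forall$-R: $\Gamma\vdash\Delta,[c/x]B\,/\,\Gamma\vdash\Delta,\forall x B$, for a constant $c$ that does not appear in the conclusion. An I-proof is a derivation from axioms by these rules in which every sequent has exactly one formula in its succedent. A uniform proof (O-proof) is an I-proof in which every sequent whose succedent formula is neither atomic nor $\bot$ occurs only as the conclusion of the rule that introduces the top-level logical symbol of that formula (for $\top$: only as an axiom). Say that a set of rules is *restricted* if (1) either it does not contain $\lor$-L, or it contains neither $\lor$-R nor $\exists$-R;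 and (2) either it does not contain $\exists$-L or it does not contain $\exists$-R. **Theorem.** (a) Let $\Gamma$ be a multiset of formulas and $G$ a formula. If $\Gamma\vdash G$ has an I-proof for which the set of rules used is restricted, then $\Gamma\vdash G$ has a uniform proof. (b) The criterion is tight. Suppose that the signature has at least one predicate symbol of positive arity. Then for each set $U\subseteq\{\lor\text{-L},\lor\text{-R},\exists\text{-L},\exists\text{-R}\}$ that is not restricted (in particular for $\{\lor\text{-L},\exists\text{-R}\}$, $\{\lor\text{-L},\lor\text{-R}\}$ and $\{\exists\text{-L},\exists\text{-R}\}$), there is a sequent $\Gamma\vdash G$ that has an I-proof in which exactly the rules in $U$ are used, but that has no uniform proof. -/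

import Mathlib

universe u v

namespace UnifProv

/-- Formulas of first-order logic (without equality) over the signature `L`, in de Bruijn notation:
inside `k` quantifiers the variables `0, …, k - 1` are bound (`0` by the innermost quantifier)
and the variable `k + i` is the free variable number `i`.
Formulas that differ only in the names of bound variables are thereby identified. -/
inductive Fm (L : FirstOrder.Language.{u, v}) : Type (max u v)
  | top : Fm L
  | bot : Fm L
  | atom {n : ℕ} (R : L.Relations n) (ts : Fin n → L.Term ℕ) : Fm L
  | and (A B : Fm L) : Fm L
  | or (A B : Fm L) : Fm L
  | imp (A B : Fm L) : Fm L
  | all (A : Fm L) : Fm L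
  | ex (A : Fm L) : Fm L

variable {L : FirstOrder.Language.{u, v}}

/-- The constants that appear in a term. -/
def termConsts : L.Term ℕ → Set L.Constants
  | .var _ => ∅
  | @FirstOrder.Language.Term.func _ _ 0 c _ => {c}
  | @FirstOrder.Language.Term.func _ _ (_ + 1) _ ts => ⋃ i, termConsts (ts i)

/-- A substitution carried under one quantifier. -/
def liftSubst (σ : ℕ → L.Term ℕ) : ℕ → L.Term ℕ
  | 0 => .var 0
  | n + 1 => (σ n).relabel Nat.succ

namespace Fm

/-- The constants that appear in a formula. -/
def consts : Fm L → Set L.Constants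
  | top => ∅
  | bot => ∅
  | atom _ ts => ⋃ i, termConsts (ts i)
  | and A B => A.consts ∪ B.consts
  | or A B => A.consts ∪ B.consts
  | imp A B => A.consts ∪ B.consts
  | all A => A.consts
  | ex A => A.consts

/-- Simultaneous capture-avoiding substitution of terms for the free variables. -/
def subst : (ℕ → L.Term ℕ) → Fm L → Fm L
  | _, top => top
  | _, bot => bot
  | σ, atom R ts => atom R fun i => (ts i).subst σ
  | σ, and A B => and (A.subst σ) (B.subst σ)
  | σ, or A B => or (A.subst σ) (B.subst σ)
  | σ, imp A B => imp (A.subst σ) (B.subst σ)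
  | σ, all A => all (A.subst (liftSubst σ))
  | σ, ex A => ex (A.subst (liftSubst σ))

/-- `B.inst t` is the instance `[t/x]B` of the body `B` of a formula `∀ x, B` or `∃ x, B`. -/
def inst (B : Fm L) (t : L.Term ℕ) : Fm L :=
  B.subst fun
    | 0 => t
    | n + 1 => .var n

end Fm

/-- A sequent: a pair of (finite) multisets of formulas. -/
structure Sequent (L : FirstOrder.Language.{u, v}) : Type (max u v) where
  ante : Multiset (Fm L)
  succ : Multiset (Fm L)

infix:45 " ⟹ " => Sequent.mk

namespace Sequent

/-- The constants that appear in the formulas of a sequent. -/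
def consts (s : Sequent L) : Set L.Constants :=
  {c | ∃ F, (F ∈ s.ante ∨ F ∈ s.succ) ∧ c ∈ F.consts}

/-- Axioms: `⊤` is in the succedent, or `⊥` or an atomic formula is on both sides. -/
def IsAxiom (s : Sequent L) : Prop :=
  Fm.top ∈ s.succ ∨ (Fm.bot ∈ s.ante ∧ Fm.bot ∈ s.succ) ∨
    ∃ (n : ℕ) (R : L.Relations n) (ts : Fin n → L.Term ℕ),
      Fm.atom R ts ∈ s.ante ∧ Fm.atom R ts ∈ s.succ

end Sequent

/-- The names of the rule schemata. -/
inductive Rule : Type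
  | contrL | contrR | botR | andL | andR | orL | orR | impL | impR | allL | allR | exL | exR

/-- `UnaryInf r p s`: the sequent `s` follows from the upper sequent `p` by an instance of `r`. -/
inductive UnaryInf : Rule → Sequent L → Sequent L → Prop
  | contrL (B : Fm L) (Γ Δ : Multiset (Fm L)) :
      UnaryInf .contrL (B ::ₘ B ::ₘ Γ ⟹ Δ) (B ::ₘ Γ ⟹ Δ)
  | contrR (B : Fm L) (Γ Δ : Multiset (Fm L)) :
      UnaryInf .contrR (Γ ⟹ B ::ₘ B ::ₘ Δ) (Γ ⟹ B ::ₘ Δ)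
  | botR (D : Fm L) (Γ Δ : Multiset (Fm L)) :
      UnaryInf .botR (Γ ⟹ .bot ::ₘ Δ) (Γ ⟹ D ::ₘ Δ)
  | andL_left (B D : Fm L) (Γ Δ : Multiset (Fm L)) :
      UnaryInf .andL (B ::ₘ Γ ⟹ Δ) (.and B D ::ₘ Γ ⟹ Δ)
  | andL_right (B D : Fm L) (Γ Δ : Multiset (Fm L)) :
      UnaryInf .andL (D ::ₘ Γ ⟹ Δ) (.and B D ::ₘ Γ ⟹ Δ)
  | orR_left (B D : Fm L) (Γ Δ : Multiset (Fm L)) :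
      UnaryInf .orR (Γ ⟹ B ::ₘ Δ) (Γ ⟹ .or B D ::ₘ Δ)
  | orR_right (B D : Fm L) (Γ Δ : Multiset (Fm L)) :
      UnaryInf .orR (Γ ⟹ D ::ₘ Δ) (Γ ⟹ .or B D ::ₘ Δ)
  | impR (B D : Fm L) (Γ Δ : Multiset (Fm L)) :
      UnaryInf .impR (B ::ₘ Γ ⟹ D ::ₘ Δ) (Γ ⟹ .imp B D ::ₘ Δ)
  | allL (B : Fm L) (t : L.Term ℕ) (Γ Δ : Multiset (Fm L)) :
      UnaryInf .allL (B.inst t ::ₘ Γ ⟹ Δ) (.all B ::ₘ Γ ⟹ Δ)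
  | exR (B : Fm L) (t : L.Term ℕ) (Γ Δ : Multiset (Fm L)) :
      UnaryInf .exR (Γ ⟹ B.inst t ::ₘ Δ) (Γ ⟹ .ex B ::ₘ Δ)
  | exL (B : Fm L) (c : L.Constants) (Γ Δ : Multiset (Fm L))
      (hc : c ∉ (Fm.ex B ::ₘ Γ ⟹ Δ).consts) :
      UnaryInf .exL (B.inst c.term ::ₘ Γ ⟹ Δ) (.ex B ::ₘ Γ ⟹ Δ)
  | allR (B : Fm L) (c : L.Constants) (Γ Δ : Multiset (Fm L))
      (hc : c ∉ (Γ ⟹ Fm.all B ::ₘ Δ).consts) :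
      UnaryInf .allR (Γ ⟹ B.inst c.term ::ₘ Δ) (Γ ⟹ .all B ::ₘ Δ)

/-- `BinaryInf r p q s`: the sequent `s` follows from the upper sequents `p` (left) and
`q` (right) by an instance of `r`. -/
inductive BinaryInf : Rule → Sequent L → Sequent L → Sequent L → Prop
  | orL (B D : Fm L) (Γ Δ : Multiset (Fm L)) :
      BinaryInf .orL (B ::ₘ Γ ⟹ Δ) (D ::ₘ Γ ⟹ Δ) (.or B D ::ₘ Γ ⟹ Δ)
  | andR (B D : Fm L) (Γ Δ : Multiset (Fm L)) :
      BinaryInf .andR (Γ ⟹ B ::ₘ Δ) (Γ ⟹ D ::ₘ Δ) (Γ ⟹ .and B D ::ₘ Δ)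
  | impL (B D : Fm L) (Γ Δ Θ : Multiset (Fm L)) :
      BinaryInf .impL (Γ ⟹ B ::ₘ Δ) (D ::ₘ Γ ⟹ Θ) (.imp B D ::ₘ Γ ⟹ Δ + Θ)

/-- C-proofs: derivation trees with arbitrary uses of the rules. -/
inductive CProof : Sequent L → Type (max u v)
  | ax {s : Sequent L} (h : s.IsAxiom) : CProof s
  | unary {s p : Sequent L} (r : Rule) (h : UnaryInf r p s) (π : CProof p) : CProof s
  | binary {s p q : Sequent L} (r : Rule) (h : BinaryInf r p q s)
      (π : CProof p) (ρ : CProof q) : CProof s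

/-- The rule whose application introduces the top-level symbol of a formula in the succedent.
There is none for atomic formulas and `⊥`, nor for `⊤`, which is introduced by an axiom. -/
def Fm.introRule : Fm L → Option Rule
  | .top => none
  | .bot => none
  | .atom _ _ => none
  | .and _ _ => some .andR
  | .or _ _ => some .orR
  | .imp _ _ => some .impR
  | .all _ => some .allR
  | .ex _ => some .exR

/-- The formula is neither atomic nor `⊥`. -/
def Fm.IsCompound : Fm L → Prop
  | .bot => False
  | .atom _ _ => False
  | _ => True

namespace CProof

/-- The set of rule schemata that are used in a derivation. -/
def rules : {s : Sequent L} → CProof s → Set Rule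
  | _, .ax _ => ∅
  | _, .unary r _ π => {r} ∪ π.rules
  | _, .binary r _ π ρ => {r} ∪ π.rules ∪ ρ.rules

/-- I-proofs: every sequent in the derivation has exactly one formula in its succedent. -/
def IsIProof : {s : Sequent L} → CProof s → Prop
  | s, .ax _ => s.succ.card = 1
  | s, .unary _ _ π => s.succ.card = 1 ∧ π.IsIProof
  | s, .binary _ _ π ρ => s.succ.card = 1 ∧ π.IsIProof ∧ ρ.IsIProof

/-- Every sequent of the derivation with a formula in its succedent that is neither atomic nor `⊥`
occurs only as the conclusion of the rule that introduces the top-level symbol of that formula;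
for `⊤`, this rule is the axiom with `⊤` in its succedent. -/
def IsGoalDirected : {s : Sequent L} → CProof s → Prop
  | s, .ax _ => ∀ F ∈ s.succ, F.IsCompound → F = .top
  | s, .unary r _ π => (∀ F ∈ s.succ, F.IsCompound → F.introRule = some r) ∧ π.IsGoalDirected
  | s, .binary r _ π ρ => (∀ F ∈ s.succ, F.IsCompound → F.introRule = some r) ∧
      π.IsGoalDirected ∧ ρ.IsGoalDirected

/-- Uniform proofs (O-proofs). -/
def IsUniform {s : Sequent L} (π : CProof s) : Prop :=
  π.IsIProof ∧ π.IsGoalDirected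

end CProof

/-- The two restrictions on a set `U` of rule schemata: no `∨`-L, or neither `∨`-R nor `∃`-R;
and no `∃`-L, or no `∃`-R. -/
def Restricted (U : Set Rule) : Prop :=
  (Rule.orL ∉ U ∨ (Rule.orR ∉ U ∧ Rule.exR ∉ U)) ∧ (Rule.exL ∉ U ∨ Rule.exR ∉ U)

end UnifProv

namespace UnifProv

open Filter

variable {L : FirstOrder.Language.{u, v}}

/-! ### Finiteness of the set of constants, and renaming of constants -/

/-! Part (a). Read a goal by breaking it up completely into prime formulas (`Forced`); right rules
act on this reading directly. A left rule can be permuted above the right rules when the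
quantification over its premises commutes with the top connective of the goal. For `∧`, `⊃` and `∀`
this always holds. Rules that keep the goal in a single premise also commute with `∨` and `∃`. The
two premises of `∨`-L may choose different disjuncts or witnesses, so `∨`-L commutes with neither.
`∃`-L, read as "for infinitely many constants", commutes with `∨` by the pigeonhole principle, but
not with `∃`, since the witness may depend on the constant. These are exactly the pairs of rules
that a restricted set excludes. A disjunction or existential whose right rule is excluded can only
originate from `⊥`-R, so its reading may be taken to be provability of the prime goal `⊥`, past
which every left rule permutes. `CProof.IsIProof.forced` carries this out by induction on the
I-proof, `Forced.left_rule` being the permutation argument. `Forced.uProv` and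
`UProv.exists_uniform` turn the result into a uniform proof.

Part (b). A uniform proof of a disjunction or existential ends with its right rule, so it commits to
a disjunct or witness before the antecedent is analysed. For antecedents such as `R a ∨ R b` or `∃
x, R x` no such commitment is right, because no single `R t` follows from them
(`CProof.IsIProof.not_prim`). One sequent is given for each of the eight unrestricted sets. -/

theorem termConsts_finite : ∀ t : L.Term ℕ, (termConsts t).Finite
  | .var _ => Set.finite_empty
  | @FirstOrder.Language.Term.func _ _ 0 c _ => Set.finite_singleton c
  | @FirstOrder.Language.Term.func _ _ (_ + 1) _ ts =>
    Set.finite_iUnion fun i => termConsts_finite (ts i)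

theorem Fm.consts_finite : ∀ A : Fm L, A.consts.Finite
  | top => Set.finite_empty
  | bot => Set.finite_empty
  | atom _ ts => Set.finite_iUnion fun i => termConsts_finite (ts i)
  | and A B => A.consts_finite.union B.consts_finite
  | or A B => A.consts_finite.union B.consts_finite
  | imp A B => A.consts_finite.union B.consts_finite
  | all A => A.consts_finite
  | ex A => A.consts_finite

theorem Sequent.consts_finite (s : Sequent L) : s.consts.Finite := by
  have h : s.consts ⊆ ⋃ F ∈ {F | F ∈ s.ante + s.succ}, Fm.consts F := by
    rintro c ⟨F, hF, hc⟩
    simp only [Set.mem_iUnion]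
    exact ⟨F, by simpa using hF, hc⟩
  refine Set.Finite.subset (Set.Finite.biUnion ?_ fun F _ => F.consts_finite) h
  classical
  exact (s.ante + s.succ).toFinset.finite_toSet.subset fun F hF => by simpa using hF

/-- Replace every constant `c` in a term by `e c`. -/
def termMap (e : L.Constants → L.Constants) : L.Term ℕ → L.Term ℕ
  | .var n => .var n
  | @FirstOrder.Language.Term.func _ _ 0 c ts =>
    @FirstOrder.Language.Term.func _ _ 0 (e c) ts
  | @FirstOrder.Language.Term.func _ _ (_ + 1) f ts => .func f fun i => termMap e (ts i)

/-- Replace every constant `c` in a formula by `e c`. -/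
def Fm.mapConsts (e : L.Constants → L.Constants) : Fm L → Fm L
  | top => top
  | bot => bot
  | atom R ts => atom R fun i => termMap e (ts i)
  | and A B => and (A.mapConsts e) (B.mapConsts e)
  | or A B => or (A.mapConsts e) (B.mapConsts e)
  | imp A B => imp (A.mapConsts e) (B.mapConsts e)
  | all A => all (A.mapConsts e)
  | ex A => ex (A.mapConsts e)

theorem termMap_subst (e : L.Constants → L.Constants) (σ : ℕ → L.Term ℕ) :
    ∀ t : L.Term ℕ, termMap e (t.subst σ) = (termMap e t).subst fun n => termMap e (σ n)
  | .var _ => rfl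
  | @FirstOrder.Language.Term.func _ _ 0 c ts => by
    simp only [FirstOrder.Language.Term.subst, termMap]
    congr 1
    exact Subsingleton.elim _ _
  | @FirstOrder.Language.Term.func _ _ (_ + 1) f ts => by
    simp only [FirstOrder.Language.Term.subst, termMap, termMap_subst]

theorem termMap_relabel (e : L.Constants → L.Constants) (g : ℕ → ℕ) :
    ∀ t : L.Term ℕ, termMap e (t.relabel g) = (termMap e t).relabel g
  | .var _ => rfl
  | @FirstOrder.Language.Term.func _ _ 0 c ts => by
    simp only [FirstOrder.Language.Term.relabel, termMap]
  | @FirstOrder.Language.Term.func _ _ (_ + 1) f ts => by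
    simp only [FirstOrder.Language.Term.relabel, termMap, termMap_relabel]

theorem termMap_liftSubst (e : L.Constants → L.Constants) (σ : ℕ → L.Term ℕ) :
    (fun n => termMap e (liftSubst σ n)) = liftSubst fun n => termMap e (σ n) := by
  funext n
  cases n with
  | zero => rfl
  | succ n => exact termMap_relabel e _ _

theorem Fm.mapConsts_subst (e : L.Constants → L.Constants) (A : Fm L) :
    ∀ σ : ℕ → L.Term ℕ,
      (A.subst σ).mapConsts e = (A.mapConsts e).subst fun n => termMap e (σ n) := by
  induction A with
  | top => intro σ; rfl
  | bot => intro σ; rfl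
  | atom R ts => intro σ; simp [subst, mapConsts, termMap_subst]
  | and A B hA hB => intro σ; simp [subst, mapConsts, hA, hB]
  | or A B hA hB => intro σ; simp [subst, mapConsts, hA, hB]
  | imp A B hA hB => intro σ; simp [subst, mapConsts, hA, hB]
  | all A hA => intro σ; simp [subst, mapConsts, hA, termMap_liftSubst]
  | ex A hA => intro σ; simp [subst, mapConsts, hA, termMap_liftSubst]

theorem Fm.mapConsts_inst (e : L.Constants → L.Constants) (A : Fm L) (t : L.Term ℕ) :
    (A.inst t).mapConsts e = (A.mapConsts e).inst (termMap e t) := by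
  rw [inst, mapConsts_subst, inst]
  congr 1
  funext n
  cases n <;> rfl

theorem termMap_congr {e e' : L.Constants → L.Constants} :
    ∀ t : L.Term ℕ, (∀ c ∈ termConsts t, e c = e' c) → termMap e t = termMap e' t
  | .var _, _ => rfl
  | @FirstOrder.Language.Term.func _ _ 0 c ts, h => by
    simp only [termMap, h c rfl]
  | @FirstOrder.Language.Term.func _ _ (_ + 1) f ts, h => by
    simp only [termMap]
    congr 1
    funext i
    exact termMap_congr (ts i) fun c hc => h c (Set.mem_iUnion.2 ⟨i, hc⟩)

theorem Fm.mapConsts_congr {e e' : L.Constants → L.Constants} (A : Fm L)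
    (h : ∀ c ∈ A.consts, e c = e' c) : A.mapConsts e = A.mapConsts e' := by
  induction A with
  | top => rfl
  | bot => rfl
  | atom R ts =>
    simp only [mapConsts]
    congr 1
    funext i
    exact termMap_congr _ fun c hc => h c (Set.mem_iUnion.2 ⟨i, hc⟩)
  | and A B hA hB =>
    simp only [mapConsts, hA fun c hc => h c (.inl hc), hB fun c hc => h c (.inr hc)]
  | or A B hA hB =>
    simp only [mapConsts, hA fun c hc => h c (.inl hc), hB fun c hc => h c (.inr hc)]
  | imp A B hA hB =>
    simp only [mapConsts, hA fun c hc => h c (.inl hc), hB fun c hc => h c (.inr hc)]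
  | all A hA => simp only [mapConsts, hA h]
  | ex A hA => simp only [mapConsts, hA h]

theorem termMap_id : ∀ t : L.Term ℕ, termMap id t = t
  | .var _ => rfl
  | @FirstOrder.Language.Term.func _ _ 0 c ts => rfl
  | @FirstOrder.Language.Term.func _ _ (_ + 1) f ts => by
    simp only [termMap, termMap_id]

theorem Fm.mapConsts_id (A : Fm L) : A.mapConsts id = A := by
  induction A <;> simp_all [mapConsts, termMap_id]

open Classical in
theorem Fm.mapConsts_update (e : L.Constants → L.Constants) {A : Fm L} {c : L.Constants}
    (h : c ∉ A.consts) (d : L.Constants) :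
    A.mapConsts (Function.update e c d) = A.mapConsts e :=
  A.mapConsts_congr fun _ hx => Function.update_of_ne (fun hxc => h (by rwa [← hxc])) _ _

open Classical in
theorem map_mapConsts_update (e : L.Constants → L.Constants) {Γ : Multiset (Fm L)}
    {c : L.Constants} (h : ∀ A ∈ Γ, c ∉ A.consts) (d : L.Constants) :
    Γ.map (Fm.mapConsts (Function.update e c d)) = Γ.map (Fm.mapConsts e) :=
  Multiset.map_congr rfl fun A hA => Fm.mapConsts_update e (h A hA) d

-- With `c` an eigenconstant, redirecting it to `d` turns the premise into the instance at `d` and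
-- leaves the conclusion unchanged. Thus one premise yields premises for all constants.
open Classical in
theorem Fm.mapConsts_update_inst (e : L.Constants → L.Constants) {A : Fm L} {c : L.Constants}
    (h : c ∉ A.consts) (d : L.Constants) :
    (A.inst c.term).mapConsts (Function.update e c d) = (A.mapConsts e).inst d.term := by
  rw [mapConsts_inst, mapConsts_update e h]
  congr 1
  simp [FirstOrder.Language.Constants.term, termMap]

/-! ### Induction on formulas up to instantiation. -/

/-- The number of logical symbols of a formula. -/
def Fm.size : Fm L → ℕ
  | top => 0
  | bot => 0
  | atom _ _ => 0
  | and A B => A.size + B.size + 1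
  | or A B => A.size + B.size + 1
  | imp A B => A.size + B.size + 1
  | all A => A.size + 1
  | ex A => A.size + 1

theorem Fm.size_subst (A : Fm L) : ∀ σ : ℕ → L.Term ℕ, (A.subst σ).size = A.size := by
  induction A <;> simp_all [subst, size]

@[simp] theorem Fm.size_inst (A : Fm L) (t : L.Term ℕ) : (A.inst t).size = A.size :=
  A.size_subst _

/-- Induction on formulas up to instantiation of the quantified variable. -/
@[elab_as_elim]
theorem Fm.instInduction {p : Fm L → Prop} (top : p top) (bot : p bot)
    (atom : ∀ {n} (R : L.Relations n) ts, p (atom R ts))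
    (and : ∀ A B, p A → p B → p (and A B)) (or : ∀ A B, p A → p B → p (or A B))
    (imp : ∀ A B, p A → p B → p (imp A B))
    (all : ∀ A, (∀ t, p (A.inst t)) → p (all A))
    (ex : ∀ A, (∀ t, p (A.inst t)) → p (ex A)) (A : Fm L) : p A := by
  induction hn : A.size using Nat.strong_induction_on generalizing A with
  | _ n ih =>
  subst hn
  cases A with
  | top => exact top
  | bot => exact bot
  | atom R ts => exact atom R ts
  | and A B =>
    exact and A B (ih _ (by simp only [size]; omega) A rfl)
      (ih _ (by simp only [size]; omega) B rfl)
  | or A B =>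
    exact or A B (ih _ (by simp only [size]; omega) A rfl)
      (ih _ (by simp only [size]; omega) B rfl)
  | imp A B =>
    exact imp A B (ih _ (by simp only [size]; omega) A rfl)
      (ih _ (by simp only [size]; omega) B rfl)
  | all A => exact all A fun t => ih _ (by simp [size]) (A.inst t) rfl
  | ex A => exact ex A fun t => ih _ (by simp [size]) (A.inst t) rfl

/-! ### Uniform provability with implicit structural rules -/

/-- The formula is atomic or `⊥`. -/
def Fm.IsPrim : Fm L → Prop
  | .bot => True
  | .atom _ _ => True
  | _ => False

/-- Uniform provability with contraction built into the left rules: the principal formula of a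
left rule is kept. The eigenconstant conditions are replaced by premises for all constants
(`∀`-R) and for infinitely many constants (`∃`-L). -/
inductive UProv : Multiset (Fm L) → Fm L → Prop
  | ax {Γ P} : P.IsPrim → P ∈ Γ → UProv Γ P
  | botR {Γ P} : P.IsPrim → UProv Γ .bot → UProv Γ P
  | andL_left {Γ P A B} : P.IsPrim → .and A B ∈ Γ → UProv (A ::ₘ Γ) P → UProv Γ P
  | andL_right {Γ P A B} : P.IsPrim → .and A B ∈ Γ → UProv (B ::ₘ Γ) P → UProv Γ P
  | orL {Γ P A B} : P.IsPrim → .or A B ∈ Γ → UProv (A ::ₘ Γ) P → UProv (B ::ₘ Γ) P → UProv Γ P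
  | impL {Γ P A B} : P.IsPrim → .imp A B ∈ Γ → UProv Γ A → UProv (B ::ₘ Γ) P → UProv Γ P
  | allL {Γ P A} (t) : P.IsPrim → .all A ∈ Γ → UProv (A.inst t ::ₘ Γ) P → UProv Γ P
  | exL {Γ P A} (C : Set L.Constants) : P.IsPrim → .ex A ∈ Γ → C.Infinite →
      (∀ c ∈ C, UProv (A.inst c.term ::ₘ Γ) P) → UProv Γ P
  | topR {Γ} : UProv Γ .top
  | andR {Γ A B} : UProv Γ A → UProv Γ B → UProv Γ (.and A B)
  | orR_left {Γ A B} : UProv Γ A → UProv Γ (.or A B)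
  | orR_right {Γ A B} : UProv Γ B → UProv Γ (.or A B)
  | impR {Γ A B} : UProv (A ::ₘ Γ) B → UProv Γ (.imp A B)
  | allR {Γ A} : (∀ c : L.Constants, UProv Γ (A.inst c.term)) → UProv Γ (.all A)
  | exR {Γ A} (t) : UProv Γ (A.inst t) → UProv Γ (.ex A)

/-- Inclusion of multisets ignores multiplicities, so this is weakening and contraction at once. -/
theorem UProv.mono {Γ : Multiset (Fm L)} {G : Fm L} (h : UProv Γ G) :
    ∀ {Γ' : Multiset (Fm L)}, Γ ⊆ Γ' → UProv Γ' G := by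
  induction h with
  | ax hp hm => exact fun hs => .ax hp (hs hm)
  | botR hp _ ih => exact fun hs => .botR hp (ih hs)
  | andL_left hp hm _ ih =>
    exact fun hs => .andL_left hp (hs hm) (ih (Multiset.cons_subset_cons hs))
  | andL_right hp hm _ ih =>
    exact fun hs => .andL_right hp (hs hm) (ih (Multiset.cons_subset_cons hs))
  | orL hp hm _ _ ih ih' =>
    exact fun hs => .orL hp (hs hm) (ih (Multiset.cons_subset_cons hs))
      (ih' (Multiset.cons_subset_cons hs))
  | impL hp hm _ _ ih ih' =>
    exact fun hs => .impL hp (hs hm) (ih hs) (ih' (Multiset.cons_subset_cons hs))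
  | allL t hp hm _ ih => exact fun hs => .allL t hp (hs hm) (ih (Multiset.cons_subset_cons hs))
  | exL C hp hm hC _ ih =>
    exact fun hs => .exL C hp (hs hm) hC fun c hc => ih c hc (Multiset.cons_subset_cons hs)
  | topR => exact fun _ => .topR
  | andR _ _ ih ih' => exact fun hs => .andR (ih hs) (ih' hs)
  | orR_left _ ih => exact fun hs => .orR_left (ih hs)
  | orR_right _ ih => exact fun hs => .orR_right (ih hs)
  | impR _ ih => exact fun hs => .impR (ih (Multiset.cons_subset_cons hs))
  | allR _ ih => exact fun hs => .allR fun c => ih c hs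
  | exR t _ ih => exact fun hs => .exR t (ih hs)

/-- Uniformity forbids `⊥`-R at a compound goal, so the goal is first reduced to prime ones. Any
disjunct and any witness will do. -/
theorem UProv.exfalso {G : Fm L} : ∀ {Γ : Multiset (Fm L)}, UProv Γ .bot → UProv Γ G := by
  induction G using Fm.instInduction with
  | top => exact fun _ => .topR
  | bot => exact id
  | atom R ts => exact fun h => .botR trivial h
  | and A B hA hB => exact fun h => .andR (hA h) (hB h)
  | or A B hA hB => exact fun h => .orR_left (hA h)
  | imp A B hA hB => exact fun h => .impR (hB (h.mono (Multiset.subset_cons _ _)))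
  | all A hA => exact fun h => .allR fun c => hA _ h
  | ex A hA => exact fun h => .exR (.var 0) (hA _ h)

theorem Fm.IsPrim.not_isCompound {P : Fm L} (h : P.IsPrim) : ¬ P.IsCompound := by
  cases P <;> simp_all [IsPrim, IsCompound]

theorem CProof.exists_uniform_unary {Γ Γ' : Multiset (Fm L)} {G G' : Fm L} (r : Rule)
    (h : UnaryInf r (Γ' ⟹ {G'}) (Γ ⟹ {G})) (hG : G.IsPrim ∨ G.introRule = some r)
    (hp : ∃ ρ : CProof (Γ' ⟹ {G'}), ρ.IsUniform) : ∃ ρ : CProof (Γ ⟹ {G}), ρ.IsUniform := by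
  obtain ⟨ρ, h1, h2⟩ := hp
  refine ⟨.unary r h ρ, ⟨rfl, h1⟩, ?_, h2⟩
  intro F hF hc
  obtain rfl := Multiset.mem_singleton.1 hF
  exact hG.resolve_left fun hP => hP.not_isCompound hc

theorem CProof.exists_uniform_binary {Γ Γ' Γ'' : Multiset (Fm L)} {G G' G'' : Fm L} (r : Rule)
    (h : BinaryInf r (Γ' ⟹ {G'}) (Γ'' ⟹ {G''}) (Γ ⟹ {G}))
    (hG : G.IsPrim ∨ G.introRule = some r)
    (hp : ∃ ρ : CProof (Γ' ⟹ {G'}), ρ.IsUniform)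
    (hq : ∃ ρ : CProof (Γ'' ⟹ {G''}), ρ.IsUniform) :
    ∃ ρ : CProof (Γ ⟹ {G}), ρ.IsUniform := by
  obtain ⟨ρ, h1, h2⟩ := hp
  obtain ⟨ρ', h1', h2'⟩ := hq
  refine ⟨.binary r h ρ ρ', ⟨rfl, h1, h1'⟩, ?_, h2, h2'⟩
  intro F hF hc
  obtain rfl := Multiset.mem_singleton.1 hF
  exact hG.resolve_left fun hP => hP.not_isCompound hc

/-- Contraction of a formula that is a member of the antecedent. -/
theorem CProof.exists_uniform_contr {Γ : Multiset (Fm L)} {A P : Fm L} (hP : P.IsPrim)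
    (hA : A ∈ Γ) (hp : ∃ ρ : CProof (A ::ₘ Γ ⟹ {P}), ρ.IsUniform) :
    ∃ ρ : CProof (Γ ⟹ {P}), ρ.IsUniform := by
  obtain ⟨Γ, rfl⟩ := Multiset.exists_cons_of_mem hA
  exact exists_uniform_unary _ (.contrL A Γ {P}) (.inl hP) hp

theorem UProv.exists_uniform [Infinite L.Constants] {Γ : Multiset (Fm L)} {G : Fm L}
    (h : UProv Γ G) : ∃ ρ : CProof (Γ ⟹ {G}), ρ.IsUniform := by
  induction h with
  | @ax Γ P hp hm =>
    have hax : (Γ ⟹ {P}).IsAxiom := by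
      cases P with
      | bot => exact .inr (.inl ⟨hm, by simp⟩)
      | atom R ts => exact .inr (.inr ⟨_, R, ts, hm, by simp⟩)
      | _ => exact hp.elim
    refine ⟨.ax hax, Multiset.card_singleton _, ?_⟩
    intro F hF hc
    obtain rfl := Multiset.mem_singleton.1 hF
    exact (hp.not_isCompound hc).elim
  | botR hp _ ih => exact CProof.exists_uniform_unary _ (.botR _ _ 0) (.inl hp) ih
  | andL_left hp hm _ ih =>
    exact CProof.exists_uniform_contr hp hm
      (CProof.exists_uniform_unary _ (.andL_left _ _ _ _) (.inl hp) ih)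
  | andL_right hp hm _ ih =>
    exact CProof.exists_uniform_contr hp hm
      (CProof.exists_uniform_unary _ (.andL_right _ _ _ _) (.inl hp) ih)
  | orL hp hm _ _ ih ih' =>
    exact CProof.exists_uniform_contr hp hm
      (CProof.exists_uniform_binary _ (.orL _ _ _ _) (.inl hp) ih ih')
  | @impL Γ P A B hp hm _ _ ih ih' =>
    refine CProof.exists_uniform_contr hp hm
      (CProof.exists_uniform_binary .impL ?_ (.inl hp) ih ih')
    have := BinaryInf.impL A B Γ 0 {P}
    rwa [zero_add] at this
  | allL t hp hm _ ih =>
    exact CProof.exists_uniform_contr hp hm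
      (CProof.exists_uniform_unary _ (.allL _ _ _ _) (.inl hp) ih)
  | @exL Γ P A C hp hm hC _ ih =>
    -- Only finitely many constants occur in the conclusion, so an infinite set of constants
    -- contains a legitimate eigenconstant.
    obtain ⟨c, hc, hcs⟩ := hC.exists_notMem_finite (Sequent.consts_finite (.ex A ::ₘ Γ ⟹ {P}))
    exact CProof.exists_uniform_contr hp hm
      (CProof.exists_uniform_unary _ (.exL _ c _ _ hcs) (.inl hp) (ih c hc))
  | topR =>
    refine ⟨.ax (.inl (by simp)), by simp [CProof.IsIProof], ?_⟩
    intro F hF _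
    exact Multiset.mem_singleton.1 hF
  | andR _ _ ih ih' => exact CProof.exists_uniform_binary _ (.andR _ _ _ 0) (.inr rfl) ih ih'
  | orR_left _ ih => exact CProof.exists_uniform_unary _ (.orR_left _ _ _ 0) (.inr rfl) ih
  | orR_right _ ih => exact CProof.exists_uniform_unary _ (.orR_right _ _ _ 0) (.inr rfl) ih
  | impR _ ih => exact CProof.exists_uniform_unary _ (.impR _ _ _ 0) (.inr rfl) ih
  | @allR Γ A _ ih =>
    obtain ⟨c, hcs⟩ := (Sequent.consts_finite (Γ ⟹ {.all A})).exists_notMem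
    exact CProof.exists_uniform_unary _ (.allR _ c _ 0 hcs) (.inr rfl) (ih c)
  | exR t _ ih => exact CProof.exists_uniform_unary _ (.exR _ _ _ 0) (.inr rfl) ih

/-! ### Goal-directed reading of the succedent -/

/-- Provability by decomposing the goal down to prime formulas. The flags `o` and `x` say whether
disjunctions and existential formulas are decomposed too; otherwise such a goal can only be
reached from `⊥`. -/
def Forced (o x : Prop) (Γ : Multiset (Fm L)) : Fm L → Prop
  | .top => True
  | .bot => UProv Γ .bot
  | .atom R ts => UProv Γ (.atom R ts)
  | .and A B => Forced o x Γ A ∧ Forced o x Γ B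
  | .or A B => (o ∧ (Forced o x Γ A ∨ Forced o x Γ B)) ∨ (¬ o ∧ UProv Γ .bot)
  | .imp A B => Forced o x (A ::ₘ Γ) B
  | .all A => ∀ c : L.Constants, Forced o x Γ (A.inst c.term)
  | .ex A => (x ∧ ∃ t, Forced o x Γ (A.inst t)) ∨ (¬ x ∧ UProv Γ .bot)
termination_by G => G.size
decreasing_by all_goals simp only [Fm.size, Fm.size_inst]; omega

/-- The goal clauses are the right rules of `UProv`; a goal that is not decomposed comes from `⊥` by
`UProv.exfalso`. -/
theorem Forced.uProv {o x : Prop} {G : Fm L} :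
    ∀ {Γ : Multiset (Fm L)}, Forced o x Γ G → UProv Γ G := by
  induction G using Fm.instInduction with
  | top => exact fun _ => .topR
  | bot => intro Γ h; rwa [Forced] at h
  | atom R ts => intro Γ h; rwa [Forced] at h
  | and A B hA hB => intro Γ h; rw [Forced] at h; exact .andR (hA h.1) (hB h.2)
  | or A B hA hB =>
    intro Γ h
    rw [Forced] at h
    obtain ⟨_, h | h⟩ | ⟨_, h⟩ := h
    exacts [.orR_left (hA h), .orR_right (hB h), h.exfalso]
  | imp A B hA hB => intro Γ h; rw [Forced] at h; exact .impR (hB h)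
  | all A hA => intro Γ h; rw [Forced] at h; exact .allR fun c => hA _ (h c)
  | ex A hA =>
    intro Γ h
    rw [Forced] at h
    obtain ⟨_, t, h⟩ | ⟨_, h⟩ := h
    exacts [.exR t (hA t h), h.exfalso]

theorem UProv.forced {o x : Prop} {P : Fm L} (hP : P.IsPrim) {Γ : Multiset (Fm L)}
    (h : UProv Γ P) : Forced o x Γ P := by
  cases P with
  | bot => rwa [Forced]
  | atom R ts => rwa [Forced]
  | _ => exact hP.elim

theorem Forced.exfalso {o x : Prop} {G : Fm L} :
    ∀ {Γ : Multiset (Fm L)}, UProv Γ .bot → Forced o x Γ G := by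
  induction G using Fm.instInduction with
  | top => intro Γ h; rw [Forced]; trivial
  | bot => intro Γ h; rwa [Forced]
  | atom R ts => intro Γ h; rw [Forced]; exact h.exfalso
  | and A B hA hB => intro Γ h; rw [Forced]; exact ⟨hA h, hB h⟩
  | or A B hA hB =>
    intro Γ h
    rw [Forced]
    by_cases ho : o
    exacts [.inl ⟨ho, .inl (hA h)⟩, .inr ⟨ho, h⟩]
  | imp A B hA hB => intro Γ h; rw [Forced]; exact hB (h.mono (Multiset.subset_cons _ _))
  | all A hA => intro Γ h; rw [Forced]; exact fun c => hA _ h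
  | ex A hA =>
    intro Γ h
    rw [Forced]
    by_cases hx : x
    exacts [.inl ⟨hx, .var 0, hA _ h⟩, .inr ⟨hx, h⟩]

/-- A left rule that is admissible for prime goals is admissible for all goals. The premises of
the rule are indexed by `ι`, and the monotone quantifier `Q` says how many of them are needed. -/
theorem Forced.left_rule {o x : Prop} {ι : Type*} {Q : (ι → Prop) → Prop}
    (Q_mono : ∀ {p q : ι → Prop}, (∀ i, p i → q i) → Q p → Q q)
    (Q_or : o → ∀ {p q : ι → Prop}, Q (fun i => p i ∨ q i) → Q p ∨ Q q)
    (Q_ex : x → ∀ {p : L.Term ℕ → ι → Prop}, Q (fun i => ∃ t, p t i) → ∃ t, Q (p t))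
    {G : Fm L} :
    ∀ {Γ : Multiset (Fm L)} {Γ' : ι → Multiset (Fm L)},
      (∀ (Δ : Multiset (Fm L)) (P : Fm L), P.IsPrim → Q (fun i => UProv (Γ' i + Δ) P) →
        UProv (Γ + Δ) P) →
      Q (fun i => Forced o x (Γ' i) G) → Forced o x Γ G := by
  have prim : ∀ {Γ : Multiset (Fm L)} {Γ' : ι → Multiset (Fm L)} {P : Fm L}, P.IsPrim →
      (∀ (Δ : Multiset (Fm L)) (P : Fm L), P.IsPrim → Q (fun i => UProv (Γ' i + Δ) P) →
        UProv (Γ + Δ) P) → Q (fun i => UProv (Γ' i) P) → UProv Γ P := by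
    intro Γ Γ' P hP H h
    simpa using H 0 P hP (by simpa using h)
  induction G using Fm.instInduction with
  | top => intro Γ Γ' H h; rw [Forced]; trivial
  | bot => intro Γ Γ' H h; simp only [Forced] at h ⊢; exact prim trivial H h
  | atom R ts => intro Γ Γ' H h; simp only [Forced] at h ⊢; exact prim trivial H h
  | and A B hA hB =>
    intro Γ Γ' H h
    simp only [Forced] at h ⊢
    exact ⟨hA H (Q_mono (fun _ => And.left) h), hB H (Q_mono (fun _ => And.right) h)⟩
  | or A B hA hB =>
    intro Γ Γ' H h
    simp only [Forced] at h ⊢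
    by_cases ho : o
    · refine .inl ⟨ho, ?_⟩
      replace h := Q_mono (fun i hi => (hi.resolve_right fun h => h.1 ho).2) h
      exact (Q_or ho h).imp (hA H) (hB H)
    · exact .inr ⟨ho, prim trivial H
        (Q_mono (fun i hi => (hi.resolve_left fun h => ho h.1).2) h)⟩
  | imp A B hA hB =>
    intro Γ Γ' H h
    simp only [Forced] at h ⊢
    -- The hypothesis `A` of the implication joins the context `Δ`; this is why admissibility is
    -- assumed for every extension `Δ`.
    refine hB (fun Δ P hP hQ => ?_) h
    have := H (A ::ₘ Δ) P hP
    simp only [Multiset.add_cons, Multiset.cons_add] at this hQ ⊢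
    exact this hQ
  | all A hA =>
    intro Γ Γ' H h
    simp only [Forced] at h ⊢
    exact fun c => hA _ H (Q_mono (fun i hi => hi c) h)
  | ex A hA =>
    intro Γ Γ' H h
    simp only [Forced] at h ⊢
    by_cases hx : x
    · replace h := Q_mono (fun i hi => (hi.resolve_right fun h => h.1 hx).2) h
      obtain ⟨t, ht⟩ := Q_ex hx h
      exact .inl ⟨hx, t, hA t H ht⟩
    · exact .inr ⟨hx, prim trivial H
        (Q_mono (fun i hi => (hi.resolve_left fun h => hx h.1).2) h)⟩

theorem Forced.left_unary {o x : Prop} {G : Fm L} {Γ Γ' : Multiset (Fm L)}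
    (H : ∀ (Δ : Multiset (Fm L)) (P : Fm L), P.IsPrim → UProv (Γ' + Δ) P → UProv (Γ + Δ) P)
    (h : Forced o x Γ' G) : Forced o x Γ G :=
  Forced.left_rule (ι := Unit) (Q := fun p => p ()) (Γ' := fun _ => Γ') (fun h => h ())
    (fun _ => id)
    (fun _ => id) H h

/-- Here `Q` is a conjunction of two premises, which distributes over neither `∨` nor `∃`; hence
both flags must be off. -/
theorem Forced.left_orL {o x : Prop} (ho : ¬ o) (hx : ¬ x) {G A B : Fm L}
    {Γ : Multiset (Fm L)} (hA : Forced o x (A ::ₘ Γ) G) (hB : Forced o x (B ::ₘ Γ) G) :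
    Forced o x (.or A B ::ₘ Γ) G := by
  refine Forced.left_rule (ι := Bool) (Q := fun p => p true ∧ p false)
    (Γ' := fun b => (if b then A else B) ::ₘ Γ) (fun h => And.imp (h _) (h _))
    (fun h => (ho h).elim) (fun h => (hx h).elim) (fun Δ P hP h => ?_) ⟨hA, hB⟩
  refine .orL (A := A) (B := B) hP (by simp) (h.1.mono ?_) (h.2.mono ?_) <;>
  · intro F; simp; tauto

/-- `Q` means "for infinitely many constants". It distributes over `∨`, so `o` is arbitrary, but it
does not commute with a choice of witness, so `x` must be off. -/
theorem Forced.left_exL [Infinite L.Constants] {o x : Prop} (hx : ¬ x) {G A : Fm L}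
    {Γ : Multiset (Fm L)} (h : ∀ c : L.Constants, Forced o x (A.inst c.term ::ₘ Γ) G) :
    Forced o x (.ex A ::ₘ Γ) G := by
  refine Forced.left_rule (ι := L.Constants) (Q := fun p => ∃ᶠ c in cofinite, p c)
    (Γ' := fun c => A.inst c.term ::ₘ Γ) (fun h h' => h'.mono h)
    (fun _ => frequently_or_distrib.1) (fun h => (hx h).elim) (fun Δ P hP h => ?_)
    (Frequently.of_forall h)
  refine .exL (A := A) {c | UProv (A.inst c.term ::ₘ Γ + Δ) P} hP (by simp)
    (frequently_cofinite_iff_infinite.1 h) (fun c hc => UProv.mono hc ?_)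
  intro F; simp; tauto

/-! ### From I-proofs to the goal-directed reading. -/

theorem cons_add_subset_cons_cons_add (A B : Fm L) (Γ Δ : Multiset (Fm L)) :
    A ::ₘ Γ + Δ ⊆ A ::ₘ (B ::ₘ Γ + Δ) := by
  rw [Multiset.cons_add, Multiset.cons_add]
  exact Multiset.cons_subset_cons (Multiset.subset_cons _ _)

theorem cons_eq_singleton_iff {A G : Fm L} {Δ : Multiset (Fm L)} :
    A ::ₘ Δ = {G} ↔ A = G ∧ Δ = 0 := by
  constructor
  · intro h
    have h0 : Δ = 0 := by
      have := congrArg Multiset.card h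
      simpa using this
    subst h0
    exact ⟨Multiset.singleton_inj.1 h, rfl⟩
  · rintro ⟨rfl, rfl⟩; rfl

theorem CProof.IsIProof.card_succ {s : Sequent L} {π : CProof s} (h : π.IsIProof) :
    s.succ.card = 1 := by
  cases π with
  | ax => exact h
  | unary => exact h.1
  | binary => exact h.1

-- The map `e` is arbitrary, not necessarily injective, so that in the cases of `∃`-L and `∀`-R the
-- induction hypothesis can be used with the eigenconstant sent to any constant.
open Classical in
theorem CProof.IsIProof.forced [Infinite L.Constants] {o x : Prop} {s : Sequent L}
    (π : CProof s) (hπ : π.IsIProof)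
    (h_orL : Rule.orL ∈ π.rules → ¬ o ∧ ¬ x) (h_exL : Rule.exL ∈ π.rules → ¬ x)
    (h_orR : Rule.orR ∈ π.rules → o) (h_exR : Rule.exR ∈ π.rules → x) :
    ∀ (e : L.Constants → L.Constants) (G : Fm L), s.succ = {G} →
      Forced o x (s.ante.map (Fm.mapConsts e)) (G.mapConsts e) := by
  induction π with
  | @ax s h =>
    intro e G hG
    obtain h | ⟨h1, h2⟩ | ⟨n, R, ts, h1, h2⟩ := h
    · rw [hG, Multiset.mem_singleton] at h
      subst h
      rw [Fm.mapConsts, Forced]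
      trivial
    · rw [hG, Multiset.mem_singleton] at h2
      subst h2
      exact UProv.forced (P := .bot) trivial (.ax trivial (Multiset.mem_map_of_mem _ h1))
    · rw [hG, Multiset.mem_singleton] at h2
      subst h2
      exact UProv.forced (P := .atom R _) trivial (.ax trivial (Multiset.mem_map_of_mem _ h1))
  | unary r h π ih =>
    intro e G hG
    have hsub : ∀ {q}, q ∈ π.rules → q ∈ (CProof.unary r h π).rules := fun hq => .inr hq
    have hr : r ∈ (CProof.unary r h π).rules := .inl rfl
    replace ih := ih hπ.2 (fun hq => h_orL (hsub hq)) (fun hq => h_exL (hsub hq))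
      (fun hq => h_orR (hsub hq)) (fun hq => h_exR (hsub hq))
    have hcard := hπ.2.card_succ
    clear hsub
    cases h with
    | contrL B Γ Δ =>
      refine Forced.left_unary (fun Θ P hP hU => hU.mono ?_) (ih e G hG)
      intro F; simp
    | contrR B Γ Δ => simp at hcard
    | botR D Γ Δ =>
      obtain ⟨rfl, rfl⟩ := cons_eq_singleton_iff.1 hG
      have := ih e .bot rfl
      rw [Fm.mapConsts, Forced] at this
      exact Forced.exfalso this
    | andL_left B D Γ Δ =>
      refine Forced.left_unary (fun Θ P hP hU => ?_) (ih e G hG)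
      rw [Multiset.map_cons] at hU ⊢
      refine .andL_left (A := B.mapConsts e) (B := D.mapConsts e) hP (by simp [Fm.mapConsts])
        (hU.mono ?_)
      exact cons_add_subset_cons_cons_add _ _ _ _
    | andL_right B D Γ Δ =>
      refine Forced.left_unary (fun Θ P hP hU => ?_) (ih e G hG)
      rw [Multiset.map_cons] at hU ⊢
      refine .andL_right (A := B.mapConsts e) (B := D.mapConsts e) hP (by simp [Fm.mapConsts])
        (hU.mono ?_)
      exact cons_add_subset_cons_cons_add _ _ _ _
    | orR_left B D Γ Δ =>
      obtain ⟨rfl, rfl⟩ := cons_eq_singleton_iff.1 hG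
      rw [Fm.mapConsts, Forced]
      exact .inl ⟨h_orR hr, .inl (ih e B rfl)⟩
    | orR_right B D Γ Δ =>
      obtain ⟨rfl, rfl⟩ := cons_eq_singleton_iff.1 hG
      rw [Fm.mapConsts, Forced]
      exact .inl ⟨h_orR hr, .inr (ih e D rfl)⟩
    | impR B D Γ Δ =>
      obtain ⟨rfl, rfl⟩ := cons_eq_singleton_iff.1 hG
      rw [Fm.mapConsts, Forced]
      simpa using ih e D rfl
    | allL B t Γ Δ =>
      refine Forced.left_unary (fun Θ P hP hU => ?_) (ih e G hG)
      rw [Multiset.map_cons] at hU ⊢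
      refine .allL (A := B.mapConsts e) (termMap e t) hP (by simp [Fm.mapConsts])
        (hU.mono ?_)
      rw [Fm.mapConsts_inst]
      exact cons_add_subset_cons_cons_add _ _ _ _
    | exR B t Γ Δ =>
      obtain ⟨rfl, rfl⟩ := cons_eq_singleton_iff.1 hG
      rw [Fm.mapConsts, Forced]
      refine .inl ⟨h_exR hr, termMap e t, ?_⟩
      rw [← Fm.mapConsts_inst]
      exact ih e _ rfl
    | exL B c Γ Δ hc =>
      replace hG : Δ = {G} := hG
      subst hG
      rw [Multiset.map_cons, Fm.mapConsts]
      refine Forced.left_exL (h_exL hr) fun d => ?_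
      have := ih (Function.update e c d) G rfl
      rw [Multiset.map_cons,
        Fm.mapConsts_update_inst e (A := B) fun h => hc ⟨.ex B, .inl (by simp), h⟩,
        Fm.mapConsts_update e fun h => hc ⟨G, .inr (by simp), h⟩,
        map_mapConsts_update e fun A hA h => hc ⟨A, .inl (by simp [hA]), h⟩] at this
      exact this
    | allR B c Γ Δ hc =>
      obtain ⟨rfl, rfl⟩ := cons_eq_singleton_iff.1 hG
      rw [Fm.mapConsts, Forced]
      intro d
      have := ih (Function.update e c d) _ rfl
      rw [Fm.mapConsts_update_inst e (A := B) fun h => hc ⟨.all B, .inr (by simp), h⟩,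
        map_mapConsts_update e fun A hA h => hc ⟨A, .inl hA, h⟩] at this
      exact this
  | binary r h π ρ ih ih' =>
    intro e G hG
    have hsub : ∀ {q}, q ∈ π.rules → q ∈ (CProof.binary r h π ρ).rules := fun hq => .inl (.inr hq)
    have hsub' : ∀ {q}, q ∈ ρ.rules → q ∈ (CProof.binary r h π ρ).rules := fun hq => .inr hq
    have hr : r ∈ (CProof.binary r h π ρ).rules := .inl (.inl rfl)
    replace ih := ih hπ.2.1 (fun hq => h_orL (hsub hq)) (fun hq => h_exL (hsub hq))
      (fun hq => h_orR (hsub hq)) (fun hq => h_exR (hsub hq))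
    replace ih' := ih' hπ.2.2 (fun hq => h_orL (hsub' hq)) (fun hq => h_exL (hsub' hq))
      (fun hq => h_orR (hsub' hq)) (fun hq => h_exR (hsub' hq))
    have hcard := hπ.2.1.card_succ
    clear hsub hsub'
    cases h with
    | orL B D Γ Δ =>
      have h1 := ih e G hG
      have h2 := ih' e G hG
      simp only [Multiset.map_cons, Fm.mapConsts] at h1 h2 ⊢
      exact Forced.left_orL (h_orL hr).1 (h_orL hr).2 h1 h2
    | andR B D Γ Δ =>
      obtain ⟨rfl, rfl⟩ := cons_eq_singleton_iff.1 hG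
      rw [Fm.mapConsts, Forced]
      exact ⟨ih e B rfl, ih' e D rfl⟩
    | impL B D Γ Δ Θ =>
      -- The left premise has succedent `B ::ₘ Δ`, and an I-proof allows it only one formula.
      obtain rfl : Δ = 0 := by simpa using hcard
      have h1 := (ih e B rfl).uProv
      refine Forced.left_unary (fun Ξ P hP hU => ?_) (ih' e G (by simpa using hG))
      rw [Multiset.map_cons] at hU ⊢
      refine .impL (A := B.mapConsts e) (B := D.mapConsts e) hP (by simp [Fm.mapConsts])
        (h1.mono ?_) (hU.mono ?_)
      · exact fun F hF => Multiset.mem_add.2 (.inl (Multiset.mem_cons_of_mem hF))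
      · exact cons_add_subset_cons_cons_add _ _ _ _

theorem CProof.IsIProof.exists_uniform [Infinite L.Constants] {Γ : Multiset (Fm L)} {G : Fm L}
    (π : CProof (Γ ⟹ {G})) (hπ : π.IsIProof) (hr : Restricted π.rules) :
    ∃ ρ : CProof (Γ ⟹ {G}), ρ.IsUniform := by
  -- A flag is on exactly when no left rule that conflicts with the corresponding right rule is
  -- used. Restrictedness then says that a right rule that is used has its flag on.
  have := hπ.forced (o := Rule.orL ∉ π.rules) (x := Rule.orL ∉ π.rules ∧ Rule.exL ∉ π.rules) π
    (by tauto) (by tauto) (by unfold Restricted at hr; tauto) (by unfold Restricted at hr; tauto)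
    id G rfl
  have hid : Fm.mapConsts (L := L) id = id := funext Fm.mapConsts_id
  rw [hid, Multiset.map_id] at this
  exact this.uProv.exists_uniform

/-! ### Unprovability of prime goals -/

/-- Formulas built from atomic formulas by `∨` and `∃`. -/
def Fm.IsPositive : Fm L → Prop
  | .atom _ _ => True
  | .or A B => A.IsPositive ∧ B.IsPositive
  | .ex A => A.IsPositive
  | _ => False

theorem Fm.IsPositive.subst {A : Fm L} (h : A.IsPositive) :
    ∀ σ : ℕ → L.Term ℕ, (A.subst σ).IsPositive := by
  induction A with
  | atom R ts => exact fun _ => trivial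
  | or A B hA hB => exact fun σ => ⟨hA h.1 σ, hB h.2 σ⟩
  | ex A hA => exact fun σ => hA h _
  | _ => exact h.elim

theorem Fm.IsPositive.inst {A : Fm L} (h : A.IsPositive) (t : L.Term ℕ) :
    (A.inst t).IsPositive := h.subst _

/-- A syntactic condition on a formula that keeps it from entailing the atomic formula `P`. -/
inductive Fm.Avoids (P : Fm L) : Fm L → Prop
  | atom {n} {R : L.Relations n} {ts} : .atom R ts ≠ P → Avoids P (.atom R ts)
  | or_left {A B} : Avoids P A → Avoids P (.or A B)
  | or_right {A B} : Avoids P B → Avoids P (.or A B)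
  | ex {A} : (∀ c ∉ P.consts, Avoids P (A.inst c.term)) → Avoids P (.ex A)

/-- With a positive antecedent and a prime goal, only axioms, contr-L, `⊥`-R, `∨`-L and `∃`-L can
come last. Each of these left rules has a premise that still avoids the goal. The claim about `⊥` is
proved simultaneously to exclude `⊥`-R. -/
theorem CProof.IsIProof.not_prim {s : Sequent L} (π : CProof s) (hπ : π.IsIProof)
    (hpos : ∀ A ∈ s.ante, A.IsPositive) :
    s.succ ≠ {.bot} ∧
      ∀ {n : ℕ} (R : L.Relations n) (ts : Fin n → L.Term ℕ),
        (∀ A ∈ s.ante, Fm.Avoids (.atom R ts) A) → s.succ ≠ {.atom R ts} := by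
  induction π with
  | @ax s h =>
    obtain h | ⟨h1, h2⟩ | ⟨n, R, ts, h1, h2⟩ := h
    · constructor
      · intro h'; simp [h'] at h
      · intro n R ts _ h'; simp [h'] at h
    · exact (hpos _ h1).elim
    · constructor
      · intro h'; simp [h'] at h2
      · intro n R ts hA h'
        rw [h', Multiset.mem_singleton] at h2
        have := hA _ h1
        rw [h2] at this
        cases this with
        | atom h => exact h rfl
  | unary r h π ih =>
    have hcard := hπ.2.card_succ
    replace ih := ih hπ.2
    cases h with
    | contrL B Γ Δ =>
      simp only [Multiset.forall_mem_cons] at hpos ih ⊢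
      simpa [hpos] using ih ⟨hpos.1, hpos⟩
    | contrR B Γ Δ => simp at hcard
    | botR D Γ Δ =>
      obtain rfl : Δ = 0 := by simpa using hcard
      exact ((ih hpos).1 rfl).elim
    | exL B c Γ Δ hc =>
      simp only [Multiset.forall_mem_cons] at hpos ih ⊢
      replace ih := ih ⟨Fm.IsPositive.inst (A := B) hpos.1 _, hpos.2⟩
      refine ⟨ih.1, fun R ts hA hΔ => ih.2 R ts ⟨?_, hA.2⟩ hΔ⟩
      -- The eigenconstant does not occur in the goal, which is all that `Avoids` asks of instances.
      cases hA.1 with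
      | ex h => exact h c fun h' => hc ⟨.atom R ts, .inr (by simp [hΔ]), h'⟩
    | andL_left | andL_right | allL => exact (hpos _ (Multiset.mem_cons_self _ _)).elim
    | _ =>
      constructor
      · intro h; simpa using (cons_eq_singleton_iff.1 h).1
      · intro n R ts _ h; simpa using (cons_eq_singleton_iff.1 h).1
  | binary r h π ρ ih ih' =>
    replace ih := ih hπ.2.1
    replace ih' := ih' hπ.2.2
    cases h with
    | orL B D Γ Δ =>
      simp only [Multiset.forall_mem_cons] at hpos ih ih' ⊢
      replace ih := ih ⟨hpos.1.1, hpos.2⟩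
      replace ih' := ih' ⟨hpos.1.2, hpos.2⟩
      refine ⟨ih.1, fun R ts hA => ?_⟩
      cases hA.1 with
      | or_left h => exact ih.2 R ts ⟨h, hA.2⟩
      | or_right h => exact ih'.2 R ts ⟨h, hA.2⟩
    | impL => exact (hpos _ (Multiset.mem_cons_self _ _)).elim
    | andR =>
      constructor
      · intro h; simpa using (cons_eq_singleton_iff.1 h).1
      · intro n R ts _ h; simpa using (cons_eq_singleton_iff.1 h).1

/-! ### Inversion of uniform proofs -/

/-- Goal-directedness leaves `∨`-R as the only possible last rule, and its premise is again
uniformly proved. -/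
theorem CProof.IsUniform.or_inv {s : Sequent L} {π : CProof s} (hπ : π.IsUniform) {A B : Fm L}
    (hs : s.succ = {.or A B}) :
    (∃ ρ : CProof (s.ante ⟹ {A}), ρ.IsUniform) ∨ ∃ ρ : CProof (s.ante ⟹ {B}), ρ.IsUniform := by
  have hm : Fm.or A B ∈ s.succ := by simp [hs]
  cases π with
  | ax h => cases hπ.2 _ hm trivial
  | unary r h ρ =>
    have hr := hπ.2.1 _ hm trivial
    simp only [Fm.introRule, Option.some.injEq] at hr
    subst hr
    cases h with
    | orR_left =>
      obtain ⟨h, rfl⟩ := cons_eq_singleton_iff.1 hs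
      cases h
      exact .inl ⟨ρ, hπ.1.2, hπ.2.2⟩
    | orR_right =>
      obtain ⟨h, rfl⟩ := cons_eq_singleton_iff.1 hs
      cases h
      exact .inr ⟨ρ, hπ.1.2, hπ.2.2⟩
  | binary r h =>
    have hr := hπ.2.1 _ hm trivial
    simp only [Fm.introRule, Option.some.injEq] at hr
    subst hr
    cases h

theorem CProof.IsUniform.ex_inv {s : Sequent L} {π : CProof s} (hπ : π.IsUniform) {A : Fm L}
    (hs : s.succ = {.ex A}) : ∃ (t : L.Term ℕ) (ρ : CProof (s.ante ⟹ {A.inst t})),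
      ρ.IsUniform := by
  have hm : Fm.ex A ∈ s.succ := by simp [hs]
  cases π with
  | ax h => cases hπ.2 _ hm trivial
  | unary r h ρ =>
    have hr := hπ.2.1 _ hm trivial
    simp only [Fm.introRule, Option.some.injEq] at hr
    subst hr
    cases h with
    | exR B t =>
      obtain ⟨h, rfl⟩ := cons_eq_singleton_iff.1 hs
      cases h
      exact ⟨t, ρ, hπ.1.2, hπ.2.2⟩
  | binary r h =>
    have hr := hπ.2.1 _ hm trivial
    simp only [Fm.introRule, Option.some.injEq] at hr
    subst hr
    cases h

/-! ### Tightness of the criterion -/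

/-- The atomic formula `R(t, …, t)`. -/
def Fm.diag {n : ℕ} (R : L.Relations n) (t : L.Term ℕ) : Fm L := .atom R fun _ => t

section Tight

variable {n : ℕ} (R : L.Relations (n + 1))

theorem Fm.diag_inst {n : ℕ} (R : L.Relations n) (t : L.Term ℕ) :
    (diag R (.var 0)).inst t = diag R t := rfl

theorem Fm.diag_inst_const {n : ℕ} (R : L.Relations n) (a : L.Constants) (t : L.Term ℕ) :
    (diag R a.term).inst t = diag R a.term := by
  simp only [diag, inst, subst, FirstOrder.Language.Constants.term,
    FirstOrder.Language.Term.subst]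
  congr 1
  funext _
  congr 1
  exact Subsingleton.elim _ _

theorem Fm.consts_diag (t : L.Term ℕ) : (diag R t).consts = termConsts t := by
  simp [diag, consts, Set.iUnion_const]

theorem Fm.diag_injective : Function.Injective (diag R) := by
  intro s t h
  simp only [diag, atom.injEq, heq_eq_eq, true_and] at h
  exact congrFun h 0

theorem constTerm_injective :
    Function.Injective (FirstOrder.Language.Constants.term (L := L) (α := ℕ)) := by
  intro a b h
  simp only [FirstOrder.Language.Constants.term, FirstOrder.Language.Term.func.injEq,
    heq_eq_eq, true_and] at h
  exact h.1

theorem Fm.avoids_diag {a : L.Constants} {t : L.Term ℕ} (h : a.term ≠ t) :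
    Fm.Avoids (diag R t) (diag R a.term) := .atom fun h' => h (diag_injective R h')

/-- A term `t` differs from at least one of two distinct constants. -/
theorem Fm.avoids_or_diag {a b : L.Constants} (hab : a ≠ b) (t : L.Term ℕ) :
    Fm.Avoids (diag R t) (or (diag R a.term) (diag R b.term)) := by
  by_cases h : a.term = t
  · exact .or_right (avoids_diag R fun h' => hab (constTerm_injective (h.trans h'.symm)))
  · exact .or_left (avoids_diag R h)

/-- A constant that does not occur in `t` is different from `t`. -/
theorem Fm.avoids_ex_diag (t : L.Term ℕ) :
    Fm.Avoids (diag R t) (ex (diag R (.var 0))) := by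
  refine .ex fun c hc => ?_
  rw [diag_inst]
  refine avoids_diag R ?_
  rintro rfl
  exact hc (by rw [consts_diag]; exact rfl)

theorem Fm.avoids_ex_or_diag {a b : L.Constants} (hab : a ≠ b) (t : L.Term ℕ) :
    Fm.Avoids (diag R t) (ex (or (diag R a.term) (diag R b.term))) := by
  refine .ex fun c _ => ?_
  have : (or (diag R a.term) (diag R b.term)).inst c.term =
      or (diag R a.term) (diag R b.term) :=
    congrArg₂ or (diag_inst_const R a c.term) (diag_inst_const R b c.term)
  rw [this]
  exact avoids_or_diag R hab t

variable {R} {A : Fm L}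

theorem not_uniform_diag (hpos : A.IsPositive) (hA : ∀ t, Fm.Avoids (.diag R t) A) (t : L.Term ℕ) :
    ¬ ∃ ρ : CProof ({A} ⟹ {.diag R t}), ρ.IsUniform := by
  rintro ⟨ρ, hρ⟩
  refine (hρ.1.not_prim ρ (by simpa using hpos)).2 R _ (fun F hF => ?_) rfl
  obtain rfl := Multiset.mem_singleton.1 hF
  exact hA t

theorem not_uniform_ex (hpos : A.IsPositive) (hA : ∀ t, Fm.Avoids (.diag R t) A) :
    ¬ ∃ ρ : CProof ({A} ⟹ {.ex (.diag R (.var 0))}), ρ.IsUniform := by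
  rintro ⟨ρ, hρ⟩
  obtain ⟨t, h⟩ := hρ.ex_inv rfl
  exact not_uniform_diag hpos hA t h

theorem not_uniform_or {B D : Fm L} (hB : ¬ ∃ ρ : CProof ({A} ⟹ {B}), ρ.IsUniform)
    (hD : ¬ ∃ ρ : CProof ({A} ⟹ {D}), ρ.IsUniform) :
    ¬ ∃ ρ : CProof ({A} ⟹ {.or B D}), ρ.IsUniform := by
  rintro ⟨ρ, hρ⟩
  exact (hρ.or_inv rfl).elim hB hD

/-! ### I-proofs with a prescribed set of rules. -/

/-- `A ⊢ G` has an I-proof in which exactly the rules in `U` are used. -/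
def IProvExactly (U : Set Rule) (A G : Fm L) : Prop :=
  ∃ π : CProof ({A} ⟹ {G}), π.IsIProof ∧ π.rules = U

theorem IProvExactly.diag (t : L.Term ℕ) : IProvExactly ∅ (.diag R t) (.diag R t) :=
  ⟨.ax (.inr (.inr ⟨_, R, _, Multiset.mem_singleton_self _, Multiset.mem_singleton_self _⟩)),
    by simp [CProof.IsIProof], rfl⟩

theorem IProvExactly.orL {U V : Set Rule} {A B G : Fm L} (hA : IProvExactly U A G)
    (hB : IProvExactly V B G) : IProvExactly ({.orL} ∪ U ∪ V) (.or A B) G := by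
  obtain ⟨π, h, rfl⟩ := hA
  obtain ⟨ρ, h', rfl⟩ := hB
  exact ⟨.binary .orL (.orL A B 0 {G}) π ρ, ⟨rfl, h, h'⟩, rfl⟩

theorem IProvExactly.orR_left {U : Set Rule} {A B D : Fm L} (h : IProvExactly U A B) :
    IProvExactly ({.orR} ∪ U) A (.or B D) := by
  obtain ⟨π, h, rfl⟩ := h
  exact ⟨.unary .orR (.orR_left B D {A} 0) π, ⟨rfl, h⟩, rfl⟩

theorem IProvExactly.orR_right {U : Set Rule} {A B D : Fm L} (h : IProvExactly U A D) :
    IProvExactly ({.orR} ∪ U) A (.or B D) := by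
  obtain ⟨π, h, rfl⟩ := h
  exact ⟨.unary .orR (.orR_right B D {A} 0) π, ⟨rfl, h⟩, rfl⟩

theorem IProvExactly.exR {U : Set Rule} {A B : Fm L} (t : L.Term ℕ)
    (h : IProvExactly U A (B.inst t)) : IProvExactly ({.exR} ∪ U) A (.ex B) := by
  obtain ⟨π, h, rfl⟩ := h
  exact ⟨.unary .exR (.exR B t {A} 0) π, ⟨rfl, h⟩, rfl⟩

theorem IProvExactly.exL {U : Set Rule} {A G : Fm L} (c : L.Constants) (hA : c ∉ A.consts)
    (hG : c ∉ G.consts) (h : IProvExactly U (A.inst c.term) G) :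
    IProvExactly ({.exL} ∪ U) (.ex A) G := by
  obtain ⟨π, h, rfl⟩ := h
  have hc : c ∉ (Fm.ex A ::ₘ 0 ⟹ {G}).consts := by
    rintro ⟨F, hF, hc⟩
    simp only [Multiset.cons_zero, Multiset.mem_singleton] at hF
    obtain rfl | rfl := hF
    exacts [hA hc, hG hc]
  exact ⟨.unary .exL (.exL A c 0 {G} hc) π, ⟨rfl, h⟩, rfl⟩

variable (R)

theorem iProvExactly_or_or (a b : L.Constants) :
    IProvExactly {.orL, .orR} (.or (.diag R a.term) (.diag R b.term))
      (.or (.diag R a.term) (.diag R b.term)) := by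
  convert (IProvExactly.diag (R := R) a.term).orR_left.orL
    (IProvExactly.diag (R := R) b.term).orR_right using 1
  ext r; simp [or_comm]

theorem iProvExactly_diag_ex (a : L.Constants) :
    IProvExactly {.exR} (.diag R a.term) (.ex (.diag R (.var 0))) := by
  convert IProvExactly.exR (B := .diag R (.var 0)) a.term (IProvExactly.diag (R := R) a.term)
    using 1
  ext r; simp

theorem iProvExactly_ex_ex [Infinite L.Constants] :
    IProvExactly {.exL, .exR} (.ex (.diag R (.var 0))) (.ex (.diag R (.var 0))) := by
  obtain ⟨c⟩ : Nonempty L.Constants := inferInstance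
  have h : c ∉ (Fm.diag R (.var 0)).consts := by
    rw [Fm.consts_diag]
    exact Set.notMem_empty c
  exact IProvExactly.exL c h h (iProvExactly_diag_ex R c)

/-- The quantifier is vacuous; its only role is to add `∃`-L to the rules used. -/
theorem iProvExactly_ex_or_or [Infinite L.Constants] (a b : L.Constants) :
    IProvExactly {.exL, .orL, .orR} (.ex (.or (.diag R a.term) (.diag R b.term)))
      (.or (.diag R a.term) (.diag R b.term)) := by
  obtain ⟨c, hc⟩ :=
    (Fm.consts_finite (.or (.diag R a.term) (.diag R b.term))).exists_notMem
  refine IProvExactly.exL c hc hc ?_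
  have : (Fm.or (.diag R a.term) (.diag R b.term)).inst c.term =
      .or (.diag R a.term) (.diag R b.term) :=
    congrArg₂ Fm.or (Fm.diag_inst_const R a c.term) (Fm.diag_inst_const R b c.term)
  rw [this]
  exact iProvExactly_or_or R a b

/-- The essential sequents are `D ⊢ D`, `D ⊢ E` and `E ⊢ E`. The other sets need extra rules,
supplied by padding: `E ∨ E` on the left for `∨`-L, `E ∨ E` on the right for `∨`-R, and a vacuous
`∃` before `D` for `∃`-L. -/
theorem exists_iProv_not_uniform {n : ℕ} (R : L.Relations (n + 1)) [Infinite L.Constants]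
    {U : Set Rule}
    (hU : U ⊆ {.orL, .orR, .exL, .exR}) (hr : ¬ Restricted U) :
    ∃ A G : Fm L, IProvExactly U A G ∧ ¬ ∃ ρ : CProof ({A} ⟹ {G}), ρ.IsUniform := by
  obtain ⟨a, b, hab⟩ := exists_pair_ne L.Constants
  let E : Fm L := .ex (.diag R (.var 0))
  let D : Fm L := .or (.diag R a.term) (.diag R b.term)
  have hE : E.IsPositive := trivial
  have hD : D.IsPositive := ⟨trivial, trivial⟩
  have aE : ∀ t, Fm.Avoids (.diag R t) E := Fm.avoids_ex_diag R
  have aD : ∀ t, Fm.Avoids (.diag R t) D := Fm.avoids_or_diag R hab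
  have aEE : ∀ t, Fm.Avoids (.diag R t) (E.or E) := fun t => .or_left (aE t)
  have aXD : ∀ t, Fm.Avoids (.diag R t) D.ex := Fm.avoids_ex_or_diag R hab
  have pDE := (iProvExactly_diag_ex R a).orL (iProvExactly_diag_ex R b)
  have pEE := iProvExactly_ex_ex R
  have hn : ∀ r, r ≠ .orL → r ≠ .orR → r ≠ .exL → r ≠ .exR → r ∉ U := by
    intro r h1 h2 h3 h4 hr
    simpa [h1, h2, h3, h4] using hU hr
  have key : ∀ {V : Set Rule} {A G : Fm L}, IProvExactly V A G →
      (¬ ∃ ρ : CProof ({A} ⟹ {G}), ρ.IsUniform) → U = V →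
      ∃ A G : Fm L, IProvExactly U A G ∧ ¬ ∃ ρ : CProof ({A} ⟹ {G}), ρ.IsUniform := by
    rintro V A G h1 h2 rfl
    exact ⟨A, G, h1, h2⟩
  by_cases h1 : Rule.orL ∈ U <;> by_cases h2 : Rule.orR ∈ U <;> by_cases h3 : Rule.exL ∈ U <;>
    by_cases h4 : Rule.exR ∈ U <;> simp only [Restricted, h1, h2, h3, h4, not_true_eq_false,
      not_false_eq_true, and_true, and_false, or_true, or_false] at hr
  · refine key (pEE.orL pEE).orR_left
      (not_uniform_or (not_uniform_ex ⟨hE, hE⟩ aEE) (not_uniform_ex ⟨hE, hE⟩ aEE) :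
        ¬ ∃ ρ : CProof ({E.or E} ⟹ {E.or E}), ρ.IsUniform) ?_
    ext r; cases r <;> simp [h1, h2, h3, h4, hn]
  · refine key (iProvExactly_ex_or_or R a b)
      (not_uniform_or (not_uniform_diag (A := D.ex) hD aXD _)
        (not_uniform_diag (A := D.ex) hD aXD _)) ?_
    ext r; cases r <;> simp [h1, h2, h3, h4, hn]
  · refine key pDE.orR_left (not_uniform_or (not_uniform_ex hD aD) (not_uniform_ex hD aD) :
      ¬ ∃ ρ : CProof ({D} ⟹ {E.or E}), ρ.IsUniform) ?_
    ext r; cases r <;> simp [h1, h2, h3, h4, hn]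
  · refine key (iProvExactly_or_or R a b)
      (not_uniform_or (not_uniform_diag hD aD _) (not_uniform_diag hD aD _)) ?_
    ext r; cases r <;> simp [h1, h2, h3, h4, hn]
  · refine key (pEE.orL pEE) (not_uniform_ex ⟨hE, hE⟩ aEE) ?_
    ext r; cases r <;> simp [h1, h2, h3, h4, hn]
  · refine key pDE (not_uniform_ex hD aD) ?_
    ext r; cases r <;> simp [h1, h2, h3, h4, hn]
  · refine key pEE.orR_left (not_uniform_or (not_uniform_ex hE aE) (not_uniform_ex hE aE) :
      ¬ ∃ ρ : CProof ({E} ⟹ {E.or E}), ρ.IsUniform) ?_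
    ext r; cases r <;> simp [h1, h2, h3, h4, hn]
  · refine key pEE (not_uniform_ex hE aE) ?_
    ext r; cases r <;> simp [h1, h2, h3, h4, hn]

end Tight

end UnifProv

theorem mainTheorem2 {L : FirstOrder.Language.{u, v}} [Infinite L.Constants] :
    (∀ (Γ : Multiset (UnifProv.Fm L)) (G : UnifProv.Fm L),
      (∃ π : UnifProv.CProof (UnifProv.Sequent.mk Γ {G}),
        π.IsIProof ∧ UnifProv.Restricted π.rules) →
      ∃ ρ : UnifProv.CProof (UnifProv.Sequent.mk Γ {G}), ρ.IsUniform) ∧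
    ((∃ n : ℕ, Nonempty (L.Relations (n + 1))) →
      ∀ U : Set UnifProv.Rule,
        U ⊆ {UnifProv.Rule.orL, UnifProv.Rule.orR, UnifProv.Rule.exL, UnifProv.Rule.exR} →
        ¬ UnifProv.Restricted U →
        ∃ (Γ : Multiset (UnifProv.Fm L)) (G : UnifProv.Fm L),
          (∃ π : UnifProv.CProof (UnifProv.Sequent.mk Γ {G}), π.IsIProof ∧ π.rules = U) ∧
          ¬ ∃ ρ : UnifProv.CProof (UnifProv.Sequent.mk Γ {G}), ρ.IsUniform) := by
  refine ⟨fun Γ G ⟨π, h, hr⟩ => h.exists_uniform π hr, fun ⟨n, ⟨R⟩⟩ U hU hr => ?_⟩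
  obtain ⟨A, G, h⟩ := UnifProv.exists_iProv_not_uniform R hU hr
  exact ⟨{A}, G, h⟩
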